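/- Let $\varphi:(0,1]\to\mathbb{R}_+$ be a bounded increasing function such that $s\mapsto\varphi(s)/s$ is decreasing, $\varphi(s)\ge s$ for all $s\in(0,1]$, and $\int_0^1\frac{ds}{\varphi(s)}<\infty$; put $\varphi(0)=0$. Let $\mathcal{D}$ be the set of dyadic intervals $[k2^{-j},(k+1)2^{-j})$, $j,k\in\mathbb{Z}$, of the real line, and write $|I|$ for the length of $I$ and $\langle g\rangle_I=|I|^{-1}\int_I g\,dx$. For a weight $w$ (a nonnegative locally integrable function on $\mathbb{R}$) and $I\in\mathcal{D}$ let $$N_I^w(t)=\frac{1}{|I|}\,\bigl|\{x\in I: w(x)>t\}\bigr|,\qquad \mathbf{n}(N_I^w)=\int_0^\infty\varphi\bigl(N_I^w(t)\bigr)\,dt\in[0,\infty].$$ Then there is a constant $C<\infty$, depending only on $\varphi$, such that for every weight $w$, every normalized Carleson sequence $\{a_I\}_{I\in\mathcal{D}}$, i.e. every sequence with $a_I\ge0$ and $$\sup_{I\in\mathcal{D}}\ |I|^{-1}\sum_{I'\in\mathcal{D}:\,I'\subset I}a_{I'}|I'|\le1,$$ and every real-valued $f\in L^2(w)$, $$\sum_{I\in\mathcal{D}}\frac{\langle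 fw\rangle_I^2}{\mathbf{n}(N_I^w)}\,a_I\,|I|\le C\,\|f\|_{L^2(w)}^2,\qquad \|f\|_{L^2(w)}^2=\int_{\mathbb{R}}f^2\,w\,dx.$$ Here terms with $\mathbf{n}(N_I^w)=\infty$ are $0$, and intervals $I$ on which $w=0$ almost everywhere (for which $\mathbf{n}(N_I^w)=0$) are skipped. -/

import Mathlib

open MeasureTheory Set
open scoped ENNReal NNReal

/-- Index of the dyadic interval `[pos * 2 ^ (-gen), (pos + 1) * 2 ^ (-gen))` of the real line.
Distinct indices give distinct intervals. -/
@[ext]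
structure DyadicInterval where
  gen : ℤ
  pos : ℤ

/-- The dyadic interval `[k 2⁻ʲ, (k+1) 2⁻ʲ)` itself, as a subset of `ℝ`. -/
def DyadicInterval.toSet (I : DyadicInterval) : Set ℝ :=
  Ico ((I.pos : ℝ) * (2 : ℝ) ^ (-I.gen)) (((I.pos : ℝ) + 1) * (2 : ℝ) ^ (-I.gen))

/-- The average `⟨g⟩_I = |I|⁻¹ ∫_I g`. -/
noncomputable def dyadicAverage (g : ℝ → ℝ) (I : DyadicInterval) : ℝ :=
  ⨍ x in I.toSet, g x

/-- The normalized distribution function `N_I^w(t) = |I|⁻¹ |{x ∈ I : w(x) > t}|`. -/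
noncomputable def normalizedDistribution (w : ℝ → ℝ) (I : DyadicInterval) (t : ℝ) : ℝ :=
  volume.real {x | x ∈ I.toSet ∧ t < w x} / volume.real I.toSet

/-- `n(N) = ∫₀^∞ φ(N(t)) dt ∈ [0, ∞]`, for a function `φ` that is given on `(0, 1]` and is taken
to be `0` at `0`. -/
noncomputable def bumpFunctional (φ : ℝ → ℝ) (N : ℝ → ℝ) : ℝ≥0∞ :=
  ∫⁻ t in Ioi (0 : ℝ), ENNReal.ofReal ((Ioc (0 : ℝ) 1).indicator φ (N t))

/-- A normalized Carleson sequence: nonnegative numbers `a_I` with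
`∑_{I' ⊆ I} a_{I'} |I'| ≤ |I|` for every dyadic interval `I`. -/
def IsNormalizedCarleson (a : DyadicInterval → ℝ) : Prop :=
  (∀ I, 0 ≤ a I) ∧
    ∀ I : DyadicInterval,
      ∑' J : {J : DyadicInterval // J.toSet ⊆ I.toSet},
        ENNReal.ofReal (a J.1) * volume J.1.toSet ≤ volume I.toSet

/-- The measure `w dx`. -/
noncomputable def weightMeasure (w : ℝ → ℝ) : Measure ℝ :=
  volume.withDensity fun x => ENNReal.ofReal (w x)

/-!
Write `W = w dx`. The inequality is a Carleson embedding theorem for the measure `W` and the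
coefficients `A_I = a_I |I| ⟨w⟩_I² / n(N_I)`, since `⟨f w⟩_I = ⟨w⟩_I · (W(I)⁻¹ ∫_I f dW)`. It has
two halves.

*The coefficients satisfy a Carleson condition with respect to `W`*
(`IsNormalizedCarleson.isCarleson_weightMeasure`). Put `Ψ(x) = ∫₀ˣ s / φ(s) ds`. As `φ` increases,
the part of this integral over `(x / 2, x)` already gives `x² ≤ 4 Ψ(x) φ(x)`. Since
`⟨w⟩_I = ∫₀^∞ N_I(t) dt`, the Cauchy–Schwarz inequality in `t` yields
`⟨w⟩_I² / n(N_I) ≤ 4 ∫₀^∞ Ψ(N_I(t)) dt`. For fixed `t` the number `N_I(t)` is the average over `I`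
of the indicator of `{w > t}`, so the intervals `I ⊆ J` with `N_I(t) > s` have total mass
`∑ a_I |I| ≤ s⁻¹ |{x ∈ J : w(x) > t}|`; integrating against `s / φ(s) ds` leaves the constant
`∫₀¹ ds / φ(s)`, and integrating in `t` gives `∑_{I ⊆ J} A_I ≤ 4 W(J) ∫₀¹ ds / φ(s)`.

*The weighted embedding theorem* (`IsCarleson.weighted_embedding`). The same weak-type estimate is
applied at each level `t` to the truncation `|f| 1_{|f| > t / 2}`, which carries at least half of
the average of `|f|` over an interval where that average exceeds `t`; integration in `t` gives the
`L²` bound with constant `8`.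

Both weak-type estimates are instances of `IsCarleson.mul_sum_le`, which only uses that dyadic
intervals are nested or disjoint, and `IsCarleson.sum_mul_lintegral_le` integrates it over levels.
-/

/-! ### Dyadic intervals -/

namespace DyadicInterval

theorem volume_toSet (I : DyadicInterval) :
    volume I.toSet = ENNReal.ofReal ((2 : ℝ) ^ (-I.gen)) := by
  rw [toSet, Real.volume_Ico]
  congr 1
  ring

theorem volume_toSet_ne_zero (I : DyadicInterval) : volume I.toSet ≠ 0 := by
  rw [volume_toSet, Ne, ENNReal.ofReal_eq_zero, not_le]
  positivity

theorem volume_toSet_ne_top (I : DyadicInterval) : volume I.toSet ≠ ∞ := by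
  simp [volume_toSet]

theorem measurableSet_toSet (I : DyadicInterval) : MeasurableSet I.toSet :=
  measurableSet_Ico

theorem subset_or_disjoint {J K : DyadicInterval} (h : K.gen ≤ J.gen) :
    J.toSet ⊆ K.toSet ∨ Disjoint J.toSet K.toSet := by
  obtain ⟨d, hd⟩ := Int.le.dest h
  have hu : (0 : ℝ) < 2 ^ (-J.gen) := by positivity
  have hK : (2 : ℝ) ^ (-K.gen) = ((2 ^ d : ℤ) : ℝ) * 2 ^ (-J.gen) := by
    push_cast
    rw [← zpow_natCast, ← zpow_add₀ two_ne_zero]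
    congr 1
    omega
  simp only [toSet, hK, ← mul_assoc]
  generalize (2 : ℝ) ^ (-J.gen) = u at hu
  generalize (2 ^ d : ℤ) = N
  by_cases h1 : K.pos * N ≤ J.pos
  · by_cases h2 : J.pos + 1 ≤ (K.pos + 1) * N
    · left
      apply Ico_subset_Ico <;> gcongr <;> exact_mod_cast ‹_›
    · right
      have h3 : (K.pos + 1) * N ≤ J.pos := by omega
      refine (Ico_disjoint_Ico_same).symm.mono (Ico_subset_Ico_right le_rfl)
        (Ico_subset_Ico_right ?_)
      gcongr
      exact_mod_cast h3
  · right
    have h3 : J.pos + 1 ≤ K.pos * N := by omega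
    refine Ico_disjoint_Ico_same.mono (Ico_subset_Ico_right ?_) subset_rfl
    gcongr
    exact_mod_cast h3

end DyadicInterval

open DyadicInterval

/-! ### Carleson conditions and level sets -/

/-- The Carleson condition `∑_{J ⊆ I} A_J ≤ μ(I)` with respect to a measure `μ`, imposed on finite
families of dyadic intervals. -/
def IsCarleson (A : DyadicInterval → ℝ≥0∞) (μ : Measure ℝ) : Prop :=
  ∀ (I : DyadicInterval) (F : Finset DyadicInterval), (∀ J ∈ F, J.toSet ⊆ I.toSet) →
    ∑ J ∈ F, A J ≤ μ I.toSet

/-- Weak-type estimate: if `A` is Carleson with respect to `μ` and `r μ ≤ ν` on every interval of a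
finite family, then `r ∑ A_I` is at most the `ν`-mass of the union. The maximal intervals of the
family are disjoint and each controls, by the Carleson condition, the sum over those inside it. -/
theorem IsCarleson.mul_sum_le {A : DyadicInterval → ℝ≥0∞} {μ ν : Measure ℝ}
    (hA : IsCarleson A μ) (r : ℝ≥0∞) (F : Finset DyadicInterval)
    (hF : ∀ I ∈ F, r * μ I.toSet ≤ ν I.toSet) :
    r * ∑ I ∈ F, A I ≤ ν (⋃ I ∈ F, I.toSet) := by
  classical
  induction F using Finset.strongInduction with
  | H F ih =>
    obtain rfl | hne := F.eq_empty_or_nonempty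
    · simp
    -- An interval of minimal generation is a longest one: the others lie inside it or miss it.
    obtain ⟨K, hKF, hK⟩ := F.exists_min_image DyadicInterval.gen hne
    have hsub : F.filter (fun J => ¬ J.toSet ⊆ K.toSet) ⊂ F := by
      refine Finset.filter_ssubset.2 ⟨K, hKF, by simp⟩
    have hrest := ih _ hsub fun I hI => hF I (Finset.mem_filter.1 hI).1
    have hdisj : Disjoint K.toSet (⋃ I ∈ F.filter (fun J => ¬ J.toSet ⊆ K.toSet), I.toSet) := by
      simp only [disjoint_iUnion_right, Finset.mem_filter]
      intro J hJ
      exact ((subset_or_disjoint (hK J hJ.1)).resolve_left hJ.2).symm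
    rw [← Finset.sum_filter_add_sum_filter_not F (fun J => J.toSet ⊆ K.toSet), mul_add]
    calc r * ∑ J ∈ F with J.toSet ⊆ K.toSet, A J + r * ∑ J ∈ F with ¬ J.toSet ⊆ K.toSet, A J
        ≤ ν K.toSet + ν (⋃ I ∈ F.filter (fun J => ¬ J.toSet ⊆ K.toSet), I.toSet) := by
          refine add_le_add (le_trans ?_ (hF K hKF)) hrest
          gcongr
          exact hA K _ fun J hJ => (Finset.mem_filter.1 hJ).2
      _ = ν (K.toSet ∪ ⋃ I ∈ F.filter (fun J => ¬ J.toSet ⊆ K.toSet), I.toSet) :=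
          (measure_union' hdisj K.measurableSet_toSet).symm
      _ ≤ ν (⋃ I ∈ F, I.toSet) := by
          refine measure_mono (union_subset (subset_biUnion_of_mem (u := toSet) hKF) ?_)
          exact biUnion_subset_biUnion_left fun J hJ => (Finset.mem_filter.1 hJ).1

/-- Superadditivity of the lower integral; no measurability is needed. -/
theorem sum_lintegral_le_lintegral_sum {ι α : Type*} [MeasurableSpace α] (μ : Measure α)
    (F : Finset ι) (g : ι → α → ℝ≥0∞) :
    ∑ i ∈ F, ∫⁻ t, g i t ∂μ ≤ ∫⁻ t, ∑ i ∈ F, g i t ∂μ := by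
  classical
  induction F using Finset.induction_on with
  | empty => simp
  | insert i F hi ih =>
    simp only [Finset.sum_insert hi]
    exact (add_le_add_right ih _).trans (le_lintegral_add _ _)

/-- The weak-type estimate integrated over the levels `t ∈ S` of the quantity `x_I`: the level `t`
contributes only through the intervals with `t < x_I`, on which `r(t) μ ≤ ν_t` is assumed. -/
theorem IsCarleson.sum_mul_lintegral_le {A : DyadicInterval → ℝ≥0∞} {μ : Measure ℝ}
    (hA : IsCarleson A μ) {S : Set ℝ} (hS : MeasurableSet S) (F : Finset DyadicInterval)
    (x : DyadicInterval → ℝ) (r k : ℝ → ℝ≥0∞) (ν : ℝ → Measure ℝ)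
    (h : ∀ t ∈ S, ∀ I ∈ F, t < x I → r t * μ I.toSet ≤ ν t I.toSet) :
    ∑ I ∈ F, A I * ∫⁻ t in S, (Iio (x I)).indicator (fun t => r t * k t) t
      ≤ ∫⁻ t in S, ν t univ * k t := by
  calc ∑ I ∈ F, A I * ∫⁻ t in S, (Iio (x I)).indicator (fun t => r t * k t) t
      ≤ ∑ I ∈ F, ∫⁻ t in S, A I * (Iio (x I)).indicator (fun t => r t * k t) t :=
        Finset.sum_le_sum fun I _ => lintegral_const_mul_le _ _
    _ ≤ ∫⁻ t in S, ∑ I ∈ F, A I * (Iio (x I)).indicator (fun t => r t * k t) t :=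
        sum_lintegral_le_lintegral_sum _ _ _
    _ ≤ ∫⁻ t in S, ν t univ * k t := by
        refine setLIntegral_mono' hS fun t ht => ?_
        have key := hA.mul_sum_le (ν := ν t) (r t) (F.filter fun I => t < x I) fun I hI =>
          h t ht I (Finset.mem_filter.1 hI).1 (Finset.mem_filter.1 hI).2
        calc ∑ I ∈ F, A I * (Iio (x I)).indicator (fun t => r t * k t) t
            = (r t * ∑ I ∈ F with t < x I, A I) * k t := by
              rw [Finset.sum_filter, Finset.mul_sum, Finset.sum_mul]
              refine Finset.sum_congr rfl fun I _ => ?_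
              by_cases hI : t < x I
              · rw [indicator_of_mem (mem_Iio.2 hI), if_pos hI]; ring
              · rw [indicator_of_notMem (by simpa using hI), if_neg hI]; simp
          _ ≤ ν t univ * k t := by
              gcongr
              exact key.trans (measure_mono (subset_univ _))

/-! ### The weighted Carleson embedding theorem -/

/-- The layer-cake formula `x² = ∫₀ˣ 2t dt`, with the density `2t` split as `(t / 2) · 4` so that
`t / 2` is the factor of the weak-type estimate. -/
theorem ofReal_sq_le_lintegral {x : ℝ} (hx : 0 ≤ x) :
    ENNReal.ofReal (x ^ 2)
      ≤ ∫⁻ t in Ioi (0 : ℝ), (Iio x).indicator (fun t => ENNReal.ofReal (t / 2) * 4) t := by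
  rw [lintegral_indicator measurableSet_Iio, Measure.restrict_restrict measurableSet_Iio,
    Iio_inter_Ioi]
  have h1 : ∀ t : ℝ, ENNReal.ofReal (t / 2) * 4 = ENNReal.ofReal (2 * t) := fun t => by
    rw [show (4 : ℝ≥0∞) = ENNReal.ofReal 4 by norm_num, ← ENNReal.ofReal_mul' (by norm_num)]
    congr 1
    ring
  simp only [h1]
  rw [← ofReal_integral_eq_lintegral_ofReal]
  · rw [← integral_Ioc_eq_integral_Ioo, ← intervalIntegral.integral_of_le hx]
    rw [intervalIntegral.integral_const_mul, integral_id]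
    refine ENNReal.ofReal_le_ofReal (le_of_eq ?_)
    ring
  · exact (by fun_prop : Continuous fun t : ℝ => 2 * t).integrableOn_Icc.mono_set Ioo_subset_Icc_self
  · filter_upwards [ae_restrict_mem measurableSet_Ioo] with t ht
    have := ht.1
    simp only [Pi.zero_apply]
    linarith

/-- Dyadic Carleson embedding theorem for a measure `W` that is finite on dyadic intervals. -/
theorem IsCarleson.weighted_embedding {A : DyadicInterval → ℝ≥0∞} {W : Measure ℝ} {C : ℝ≥0∞}
    (hA : IsCarleson A (C • W)) (hW : ∀ I : DyadicInterval, W I.toSet ≠ ∞)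
    {f : ℝ → ℝ} (hf : AEMeasurable f W) (F : Finset DyadicInterval) :
    ∑ I ∈ F, A I * ENNReal.ofReal (((∫⁻ x in I.toSet, ‖f x‖ₑ ∂W) / W I.toSet).toReal ^ 2)
      ≤ 8 * C * ∫⁻ x, ‖f x‖ₑ ^ 2 ∂W := by
  set V := W.withDensity fun x => ‖f x‖ₑ with hV
  set E : ℝ → Set ℝ := fun t => {x | t < 2 * |f x|} with hE
  have hE_meas : ∀ t, NullMeasurableSet (E t) W := fun t =>
    nullMeasurableSet_lt aemeasurable_const (by fun_prop)
  have htrunc : ∀ t ∈ Ioi (0 : ℝ), ∀ I ∈ F,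
      t < ((∫⁻ x in I.toSet, ‖f x‖ₑ ∂W) / W I.toSet).toReal →
      ENNReal.ofReal (t / 2) * (C • W) I.toSet ≤ (C • V.restrict (E t)) I.toSet := by
    intro t ht I _ hlt
    have ht0 : (0 : ℝ) < t := ht
    have hbig : ENNReal.ofReal t * W I.toSet ≤ ∫⁻ x in I.toSet, ‖f x‖ₑ ∂W := by
      refine ENNReal.mul_le_of_le_div ?_
      exact (ENNReal.ofReal_le_ofReal hlt.le).trans ENNReal.ofReal_toReal_le
    have hsmall : ∫⁻ x in I.toSet \ E t, ‖f x‖ₑ ∂W ≤ ENNReal.ofReal (t / 2) * W I.toSet := by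
      calc ∫⁻ x in I.toSet \ E t, ‖f x‖ₑ ∂W
          ≤ ∫⁻ _ in I.toSet \ E t, ENNReal.ofReal (t / 2) ∂W := by
            refine lintegral_mono_ae ?_
            filter_upwards [ae_restrict_mem₀
              (I.measurableSet_toSet.nullMeasurableSet.diff (hE_meas t))] with x hx
            have hx2 : ¬ t < 2 * |f x| := hx.2
            rw [← ofReal_norm, Real.norm_eq_abs]
            exact ENNReal.ofReal_le_ofReal (by linarith)
        _ ≤ ENNReal.ofReal (t / 2) * W I.toSet := by
            rw [setLIntegral_const]
            gcongr
            exact sdiff_subset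
    -- The small values of `|f|` contribute at most `t / 2` to an average exceeding `t`.
    have hsplit : ENNReal.ofReal (t / 2) * W I.toSet + ENNReal.ofReal (t / 2) * W I.toSet
        ≤ (∫⁻ x in I.toSet ∩ E t, ‖f x‖ₑ ∂W) + ENNReal.ofReal (t / 2) * W I.toSet := by
      rw [← add_mul, ← ENNReal.ofReal_add (by positivity) (by positivity), add_halves]
      refine hbig.trans ?_
      calc ∫⁻ x in I.toSet, ‖f x‖ₑ ∂W
          = ∫⁻ x in I.toSet ∩ E t ∪ I.toSet \ E t, ‖f x‖ₑ ∂W := by rw [inter_union_sdiff]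
        _ ≤ _ := (lintegral_union_le _ _ _).trans (add_le_add_right hsmall _)
    have hmain := (ENNReal.add_le_add_iff_right
      (ENNReal.mul_ne_top ENNReal.ofReal_ne_top (hW I))).1 hsplit
    rw [Measure.smul_apply, Measure.smul_apply, Measure.restrict_apply I.measurableSet_toSet,
      smul_eq_mul, smul_eq_mul, mul_left_comm]
    gcongr
    exact hmain.trans (withDensity_apply_le _ _)
  calc ∑ I ∈ F, A I * ENNReal.ofReal (((∫⁻ x in I.toSet, ‖f x‖ₑ ∂W) / W I.toSet).toReal ^ 2)
      ≤ ∫⁻ t in Ioi (0 : ℝ), (C • V.restrict (E t)) univ * 4 := by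
        refine le_trans (Finset.sum_le_sum fun I _ => ?_)
          (hA.sum_mul_lintegral_le measurableSet_Ioi F _ _ (fun _ => 4) _ htrunc)
        gcongr
        exact ofReal_sq_le_lintegral ENNReal.toReal_nonneg
    _ = 4 * C * ∫⁻ t in Ioi (0 : ℝ), V (E t) := by
        have hm : Measurable fun t => V (E t) := by
          refine Antitone.measurable fun s t hst => measure_mono fun x hx => ?_
          exact lt_of_le_of_lt hst hx
        rw [← lintegral_const_mul _ hm]
        refine lintegral_congr fun t => ?_
        simp only [Measure.smul_apply, Measure.restrict_apply_univ, smul_eq_mul]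
        ring
    _ = 4 * C * ∫⁻ x, ENNReal.ofReal (2 * |f x|) ∂V := by
        rw [lintegral_eq_lintegral_meas_lt]
        · exact Filter.Eventually.of_forall fun x => by positivity
        · have : AEMeasurable f V := hf.mono_ac (withDensity_absolutelyContinuous _ _)
          fun_prop
    _ = 8 * C * ∫⁻ x, ‖f x‖ₑ ^ 2 ∂W := by
        rw [lintegral_withDensity_eq_lintegral_mul₀ (by fun_prop) (by fun_prop)]
        have h1 : ∀ x, ((fun x => ‖f x‖ₑ) * fun x => ENNReal.ofReal (2 * |f x|)) x
            = 2 * ‖f x‖ₑ ^ 2 := fun x => by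
          simp only [Pi.mul_apply]
          rw [ENNReal.ofReal_mul zero_le_two, ← Real.norm_eq_abs, ofReal_norm,
            ENNReal.ofReal_ofNat]
          ring
        rw [lintegral_congr h1, lintegral_const_mul'' _ (by fun_prop), ← mul_assoc]
        congr 1
        ring

/-! ### Distribution functions and the bump functional -/

/-- The layer function `Ψ(x) = ∫₀^{min(x, 1)} s / φ(s) ds`. The cut-off at `x` is an indicator in
the integrand, in the form used by `IsCarleson.sum_mul_lintegral_le`. -/
noncomputable def bumpLayer (φ : ℝ → ℝ) (x : ℝ) : ℝ≥0∞ :=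
  ∫⁻ t in Ioc (0 : ℝ) 1,
    (Iio x).indicator (fun t => ENNReal.ofReal t * ENNReal.ofReal (1 / φ t)) t

theorem bumpLayer_mono (φ : ℝ → ℝ) : Monotone (bumpLayer φ) := fun _ _ hxy =>
  lintegral_mono (indicator_le_indicator_of_subset (Iio_subset_Iio hxy) fun _ => zero_le)

/-- The pointwise inequality `x² ≤ 4 Ψ(x) φ(x)`: on `(x / 2, x)` the integrand `s / φ(s)` of `Ψ` is
at least `(x / 2) / φ(x)`. -/
theorem ofReal_sq_le_bumpLayer_mul {φ : ℝ → ℝ} (hφ_mono : MonotoneOn φ (Ioc 0 1))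
    (hφ_ge : ∀ s ∈ Ioc (0 : ℝ) 1, s ≤ φ s) {x : ℝ} (hx : x ∈ Icc (0 : ℝ) 1) :
    ENNReal.ofReal x ^ 2
      ≤ 4 * bumpLayer φ x * ENNReal.ofReal ((Ioc (0 : ℝ) 1).indicator φ x) := by
  obtain h0 | h0 := hx.1.eq_or_lt
  · simp [← h0]
  have hx' : x ∈ Ioc (0 : ℝ) 1 := ⟨h0, hx.2⟩
  have hφx : 0 < φ x := h0.trans_le (hφ_ge x hx')
  have key : ENNReal.ofReal (x / 2 / φ x) * ENNReal.ofReal (x / 2) ≤ bumpLayer φ x := by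
    calc ENNReal.ofReal (x / 2 / φ x) * ENNReal.ofReal (x / 2)
        = ∫⁻ _ in Ioo (x / 2) x, ENNReal.ofReal (x / 2 / φ x) := by
          rw [setLIntegral_const, Real.volume_Ioo, sub_half]
      _ ≤ ∫⁻ t in Ioo (x / 2) x,
            (Iio x).indicator (fun t => ENNReal.ofReal t * ENNReal.ofReal (1 / φ t)) t := by
          refine setLIntegral_mono' measurableSet_Ioo fun t ht => ?_
          have ht0 : 0 < t := (half_pos h0).trans ht.1
          have ht' : t ∈ Ioc (0 : ℝ) 1 := ⟨ht0, ht.2.le.trans hx.2⟩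
          rw [indicator_of_mem (mem_Iio.2 ht.2), ← ENNReal.ofReal_mul ht0.le, mul_one_div]
          have h1 := hφ_mono ht' hx' ht.2.le
          have h2 : 0 < φ t := ht0.trans_le (hφ_ge t ht')
          have h3 := ht.1.le
          gcongr
      _ ≤ bumpLayer φ x := by
          refine lintegral_mono_set fun t ht => ⟨(half_pos h0).trans ht.1, ht.2.le.trans hx.2⟩
  rw [indicator_of_mem hx']
  calc ENNReal.ofReal x ^ 2
      = 4 * (ENNReal.ofReal (x / 2 / φ x) * ENNReal.ofReal (x / 2)) * ENNReal.ofReal (φ x) := by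
        rw [show (4 : ℝ≥0∞) = ENNReal.ofReal 4 by norm_num, ← ENNReal.ofReal_pow h0.le,
          ← ENNReal.ofReal_mul (by positivity), ← ENNReal.ofReal_mul (by positivity),
          ← ENNReal.ofReal_mul (by positivity)]
        congr 1
        field_simp
        norm_num
    _ ≤ _ := by gcongr

theorem antitone_normalizedDistribution (w : ℝ → ℝ) (I : DyadicInterval) :
    Antitone (normalizedDistribution w I) := fun s t hst => by
  unfold normalizedDistribution
  refine div_le_div_of_nonneg_right (measureReal_mono ?_ ?_) measureReal_nonneg
  · exact fun x hx => ⟨hx.1, hst.trans_lt hx.2⟩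
  · exact ne_top_of_le_ne_top I.volume_toSet_ne_top (measure_mono fun x hx => hx.1)

theorem normalizedDistribution_mem_Icc (w : ℝ → ℝ) (I : DyadicInterval) (t : ℝ) :
    normalizedDistribution w I t ∈ Icc (0 : ℝ) 1 := by
  refine ⟨by unfold normalizedDistribution; positivity, div_le_one_of_le₀ ?_ measureReal_nonneg⟩
  exact measureReal_mono (fun x hx => hx.1) I.volume_toSet_ne_top

theorem ofReal_normalizedDistribution_mul (w : ℝ → ℝ) (I : DyadicInterval) (t : ℝ) :
    ENNReal.ofReal (normalizedDistribution w I t) * volume I.toSet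
      = volume {x | x ∈ I.toSet ∧ t < w x} := by
  have hpos : 0 < volume.real I.toSet :=
    ENNReal.toReal_pos I.volume_toSet_ne_zero I.volume_toSet_ne_top
  have hfin : volume {x | x ∈ I.toSet ∧ t < w x} ≠ ∞ :=
    ne_top_of_le_ne_top I.volume_toSet_ne_top (measure_mono fun x hx => hx.1)
  rw [normalizedDistribution, ENNReal.ofReal_div_of_pos hpos, ofReal_measureReal hfin,
    ofReal_measureReal I.volume_toSet_ne_top,
    ENNReal.div_mul_cancel I.volume_toSet_ne_zero I.volume_toSet_ne_top]

theorem weightMeasure_toSet {w : ℝ → ℝ} (hw : ∀ x, 0 ≤ w x) (hw_meas : AEMeasurable w)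
    (I : DyadicInterval) :
    weightMeasure w I.toSet = ∫⁻ t in Ioi (0 : ℝ), volume {x | x ∈ I.toSet ∧ t < w x} := by
  rw [weightMeasure, withDensity_apply _ I.measurableSet_toSet,
    lintegral_eq_lintegral_meas_lt _ (Filter.Eventually.of_forall hw) hw_meas.restrict]
  refine lintegral_congr fun t => ?_
  rw [Measure.restrict_apply' I.measurableSet_toSet]
  congr 1
  ext x
  exact and_comm

/-- The Cauchy–Schwarz step `⟨w⟩_I² / n(N_I) ≤ 4 ∫₀^∞ Ψ(N_I(t)) dt`. It also holds in the
degenerate cases `n(N_I) ∈ {0, ∞}`, as the inequality with `n(N_I)` multiplied out shows. -/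
theorem sq_average_div_bumpFunctional_le {φ : ℝ → ℝ} (hφ_mono : MonotoneOn φ (Ioc 0 1))
    (hφ_ge : ∀ s ∈ Ioc (0 : ℝ) 1, s ≤ φ s) {w : ℝ → ℝ} (hw : ∀ x, 0 ≤ w x)
    (hw_meas : AEMeasurable w) (I : DyadicInterval) :
    (weightMeasure w I.toSet / volume I.toSet) ^ 2
        / bumpFunctional φ (normalizedDistribution w I)
      ≤ 4 * ∫⁻ t in Ioi (0 : ℝ), bumpLayer φ (normalizedDistribution w I t) := by
  set N := normalizedDistribution w I with hN
  have hN_anti : Antitone N := antitone_normalizedDistribution w I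
  have hN_mem : ∀ t, N t ∈ Icc (0 : ℝ) 1 := normalizedDistribution_mem_Icc w I
  have hΨ : Measurable fun t => bumpLayer φ (N t) :=
    ((bumpLayer_mono φ).comp_antitone hN_anti).measurable
  have hΦ : Measurable fun t => ENNReal.ofReal ((Ioc (0 : ℝ) 1).indicator φ (N t)) := by
    refine Antitone.measurable fun s t hst => ENNReal.ofReal_le_ofReal ?_
    have hle := hN_anti hst
    by_cases h1 : N t ∈ Ioc (0 : ℝ) 1
    · have h2 : N s ∈ Ioc (0 : ℝ) 1 := ⟨h1.1.trans_le hle, (hN_mem s).2⟩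
      rw [indicator_of_mem h1, indicator_of_mem h2]
      exact hφ_mono h1 h2 hle
    · rw [indicator_of_notMem h1]
      exact indicator_nonneg (fun s hs => hs.1.le.trans (hφ_ge s hs)) _
  have hlayer : weightMeasure w I.toSet / volume I.toSet
      = ∫⁻ t in Ioi (0 : ℝ), ENNReal.ofReal (N t) := by
    symm
    rw [weightMeasure_toSet hw hw_meas, ENNReal.eq_div_iff I.volume_toSet_ne_zero
      I.volume_toSet_ne_top, mul_comm, ← lintegral_mul_const _ hN_anti.measurable.ennreal_ofReal]
    exact lintegral_congr fun t => ofReal_normalizedDistribution_mul w I t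
  have hsqrt : ∀ y : ℝ≥0∞, (y ^ (1 / 2 : ℝ)) ^ (2 : ℝ) = y := fun y => by
    rw [← ENNReal.rpow_mul]; norm_num
  have hsqrt' : ∀ y : ℝ≥0∞, (y ^ (1 / 2 : ℝ)) ^ 2 = y := fun y => by
    rw [← ENNReal.rpow_natCast, ← ENNReal.rpow_mul]; norm_num
  refine ENNReal.div_le_of_le_mul ?_
  rw [hlayer, ← lintegral_const_mul _ hΨ, bumpFunctional]
  have hCS := ENNReal.lintegral_mul_le_Lp_mul_Lq (volume.restrict (Ioi (0 : ℝ)))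
    Real.HolderConjugate.two_two
    ((hΨ.const_mul 4).pow_const (1 / 2 : ℝ)).aemeasurable (hΦ.pow_const (1 / 2 : ℝ)).aemeasurable
  simp only [hsqrt] at hCS
  calc (∫⁻ t in Ioi (0 : ℝ), ENNReal.ofReal (N t)) ^ 2
      ≤ ((∫⁻ t in Ioi (0 : ℝ), 4 * bumpLayer φ (N t)) ^ (1 / 2 : ℝ)
        * (∫⁻ t in Ioi (0 : ℝ), ENNReal.ofReal ((Ioc (0 : ℝ) 1).indicator φ (N t)))
          ^ (1 / 2 : ℝ)) ^ 2 := by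
        gcongr
        refine le_trans (lintegral_mono fun t => ?_) hCS
        rw [Pi.mul_apply, ← ENNReal.mul_rpow_of_nonneg _ _ (by norm_num)]
        refine le_trans ?_ (ENNReal.rpow_le_rpow
          (ofReal_sq_le_bumpLayer_mul hφ_mono hφ_ge (hN_mem t)) (by norm_num))
        rw [← ENNReal.rpow_natCast, ← ENNReal.rpow_mul]
        norm_num
    _ = _ := by rw [mul_pow, hsqrt', hsqrt']

/-- The Carleson estimate for the single level set `{w > t}`. -/
theorem IsCarleson.sum_bumpLayer_le {A : DyadicInterval → ℝ≥0∞} (hA : IsCarleson A volume)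
    (φ : ℝ → ℝ) (w : ℝ → ℝ) (t : ℝ) (I : DyadicInterval) (F : Finset DyadicInterval)
    (hF : ∀ J ∈ F, J.toSet ⊆ I.toSet) :
    ∑ J ∈ F, A J * bumpLayer φ (normalizedDistribution w J t)
      ≤ volume {x | x ∈ I.toSet ∧ t < w x} * ∫⁻ s in Ioc (0 : ℝ) 1, ENNReal.ofReal (1 / φ s) := by
  refine (hA.sum_mul_lintegral_le measurableSet_Ioc F _ ENNReal.ofReal
    (fun s => ENNReal.ofReal (1 / φ s))
    (fun _ => volume.restrict {x | x ∈ I.toSet ∧ t < w x}) fun s _ J hJ hs => ?_).trans ?_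
  · rw [Measure.restrict_apply J.measurableSet_toSet]
    calc ENNReal.ofReal s * volume J.toSet
        ≤ ENNReal.ofReal (normalizedDistribution w J t) * volume J.toSet := by gcongr
      _ = volume {x | x ∈ J.toSet ∧ t < w x} := ofReal_normalizedDistribution_mul w J t
      _ ≤ volume (J.toSet ∩ {x | x ∈ I.toSet ∧ t < w x}) :=
          measure_mono fun x hx => ⟨hx.1, hF J hJ hx.1, hx.2⟩
  · simp only [Measure.restrict_apply_univ]
    rw [lintegral_const_mul' _ _
      (ne_top_of_le_ne_top I.volume_toSet_ne_top (measure_mono fun x hx => hx.1))]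

theorem IsNormalizedCarleson.isCarleson {a : DyadicInterval → ℝ} (ha : IsNormalizedCarleson a) :
    IsCarleson (fun I => ENNReal.ofReal (a I) * volume I.toSet) volume := by
  classical
  intro I F hF
  refine le_trans ?_ (ha.2 I)
  rw [← Finset.sum_subtype_of_mem (p := fun J : DyadicInterval => J.toSet ⊆ I.toSet)
    (fun J => ENNReal.ofReal (a J) * volume J.toSet) hF]
  exact ENNReal.sum_le_tsum _

/-- The sequence `a_I |I| ⟨w⟩_I² / n(N_I)` satisfies a Carleson condition with respect to `w dx`. -/
theorem IsNormalizedCarleson.isCarleson_weightMeasure {φ : ℝ → ℝ}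
    (hφ_mono : MonotoneOn φ (Ioc 0 1)) (hφ_ge : ∀ s ∈ Ioc (0 : ℝ) 1, s ≤ φ s)
    {w : ℝ → ℝ} (hw : ∀ x, 0 ≤ w x) (hw_meas : AEMeasurable w)
    {a : DyadicInterval → ℝ} (ha : IsNormalizedCarleson a) :
    IsCarleson
      (fun I => ENNReal.ofReal (a I) * volume I.toSet *
        ((weightMeasure w I.toSet / volume I.toSet) ^ 2
          / bumpFunctional φ (normalizedDistribution w I)))
      ((4 * ∫⁻ s in Ioc (0 : ℝ) 1, ENNReal.ofReal (1 / φ s)) • weightMeasure w) := by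
  intro I F hF
  set K := ∫⁻ s in Ioc (0 : ℝ) 1, ENNReal.ofReal (1 / φ s) with hK
  calc _ ≤ ∑ J ∈ F, 4 * ∫⁻ t in Ioi (0 : ℝ), ENNReal.ofReal (a J) * volume J.toSet *
            bumpLayer φ (normalizedDistribution w J t) := by
        refine Finset.sum_le_sum fun J _ => ?_
        refine (mul_le_mul_right
          (sq_average_div_bumpFunctional_le hφ_mono hφ_ge hw hw_meas J) _).trans ?_
        rw [mul_left_comm]
        gcongr
        exact lintegral_const_mul_le _ _
    _ ≤ 4 * ∫⁻ t in Ioi (0 : ℝ), ∑ J ∈ F, ENNReal.ofReal (a J) * volume J.toSet *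
            bumpLayer φ (normalizedDistribution w J t) := by
        rw [← Finset.mul_sum]
        gcongr
        exact sum_lintegral_le_lintegral_sum _ _ _
    _ ≤ 4 * ∫⁻ t in Ioi (0 : ℝ), volume {x | x ∈ I.toSet ∧ t < w x} * K := by
        gcongr with t
        exact ha.isCarleson.sum_bumpLayer_le φ w t I F hF
    _ = _ := by
        have hm : Measurable fun t => volume {x | x ∈ I.toSet ∧ t < w x} :=
          Antitone.measurable fun s t hst => measure_mono fun x hx => ⟨hx.1, hst.trans_lt hx.2⟩
        rw [lintegral_mul_const _ hm, ← weightMeasure_toSet hw hw_meas, Measure.smul_apply,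
          smul_eq_mul]
        ring

/-! ### Averages of `f w` and the conclusion -/

theorem enorm_dyadicAverage_le {w : ℝ → ℝ} (hw : ∀ x, 0 ≤ w x) (hw_meas : AEMeasurable w)
    {f : ℝ → ℝ} (I : DyadicInterval) :
    ‖dyadicAverage (fun x => f x * w x) I‖ₑ
      ≤ (∫⁻ x in I.toSet, ‖f x‖ₑ ∂weightMeasure w) / volume I.toSet := by
  rw [dyadicAverage, setAverage_eq, smul_eq_mul, enorm_mul, mul_comm, ENNReal.div_eq_inv_mul,
    mul_comm]
  gcongr
  · have hpos : volume.real I.toSet ≠ 0 :=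
      (ENNReal.toReal_pos I.volume_toSet_ne_zero I.volume_toSet_ne_top).ne'
    rw [enorm_inv hpos,
      Real.enorm_of_nonneg measureReal_nonneg, ofReal_measureReal I.volume_toSet_ne_top]
  · refine (enorm_integral_le_lintegral_enorm _).trans_eq ?_
    rw [weightMeasure, setLIntegral_withDensity_eq_setLIntegral_mul_non_measurable₀ _
      (by fun_prop) _ I.measurableSet_toSet (by simp)]
    refine lintegral_congr fun x => ?_
    rw [enorm_mul, Real.enorm_of_nonneg (hw x), Pi.mul_apply, mul_comm]

/-- `⟨f w⟩_I² ≤ ⟨w⟩_I² (W(I)⁻¹ ∫_I |f| dW)²` for `W = w dx`; if `W(I) = 0`, both sides vanish. -/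
theorem ofReal_sq_dyadicAverage_le {w : ℝ → ℝ} (hw : ∀ x, 0 ≤ w x) (hw_meas : AEMeasurable w)
    {f : ℝ → ℝ} {I : DyadicInterval} (hI : weightMeasure w I.toSet ≠ ∞)
    (hf : ∫⁻ x in I.toSet, ‖f x‖ₑ ∂weightMeasure w ≠ ∞) :
    ENNReal.ofReal (dyadicAverage (fun x => f x * w x) I ^ 2)
      ≤ (weightMeasure w I.toSet / volume I.toSet) ^ 2 *
        ENNReal.ofReal (((∫⁻ x in I.toSet, ‖f x‖ₑ ∂weightMeasure w)
          / weightMeasure w I.toSet).toReal ^ 2) := by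
  have h := enorm_dyadicAverage_le hw hw_meas (f := f) I
  set W := weightMeasure w
  rw [← sq_abs, ENNReal.ofReal_pow (abs_nonneg _), ← Real.norm_eq_abs, ofReal_norm,
    ENNReal.ofReal_pow ENNReal.toReal_nonneg, ← mul_pow]
  gcongr
  refine h.trans ?_
  by_cases h0 : W I.toSet = 0
  · have : ∫⁻ x in I.toSet, ‖f x‖ₑ ∂W = 0 := setLIntegral_measure_zero _ _ h0
    simp [this]
  · rw [ENNReal.ofReal_toReal (ENNReal.div_ne_top hf h0), div_eq_mul_inv, div_eq_mul_inv,
      div_eq_mul_inv]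
    refine le_of_eq ?_
    calc _ = (W I.toSet * (W I.toSet)⁻¹) * ((∫⁻ x in I.toSet, ‖f x‖ₑ ∂W) * (volume I.toSet)⁻¹) := by
          rw [ENNReal.mul_inv_cancel h0 hI, one_mul]
      _ = _ := by ring

theorem weightMeasure_toSet_ne_top {w : ℝ → ℝ} (hw : LocallyIntegrable w volume)
    (I : DyadicInterval) : weightMeasure w I.toSet ≠ ∞ := by
  rw [weightMeasure, withDensity_apply _ I.measurableSet_toSet]
  have : IntegrableOn w I.toSet :=
    (hw.integrableOn_isCompact isCompact_Icc).mono_set Ico_subset_Icc_self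
  exact this.lintegral_lt_top.ne

theorem theoremt (φ : ℝ → ℝ)
    (hφ_bdd : BddAbove (φ '' Ioc 0 1))
    (hφ_mono : MonotoneOn φ (Ioc 0 1))
    (hφ_anti : AntitoneOn (fun s => φ s / s) (Ioc 0 1))
    (hφ_ge : ∀ s ∈ Ioc (0 : ℝ) 1, s ≤ φ s)
    (hφ_int : IntegrableOn (fun s => 1 / φ s) (Ioc 0 1) volume) :
    ∃ C : ℝ≥0, ∀ w : ℝ → ℝ, (∀ x, 0 ≤ w x) → LocallyIntegrable w volume →
      ∀ a : DyadicInterval → ℝ, IsNormalizedCarleson a →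
        ∀ f : ℝ → ℝ, MemLp f 2 (weightMeasure w) →
          ∑' I : DyadicInterval,
              ENNReal.ofReal (dyadicAverage (fun x => f x * w x) I ^ 2)
                / bumpFunctional φ (normalizedDistribution w I)
                * ENNReal.ofReal (a I) * volume I.toSet
            ≤ (C : ℝ≥0∞) * eLpNorm f 2 (weightMeasure w) ^ 2 := by
  set K := ∫⁻ s in Ioc (0 : ℝ) 1, ENNReal.ofReal (1 / φ s) with hK
  have hK_top : 8 * (4 * K) ≠ ∞ := by
    have : K ≠ ∞ := hφ_int.lintegral_lt_top.ne
    finiteness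
  refine ⟨(8 * (4 * K)).toNNReal, fun w hw hw_int a ha f hf => ?_⟩
  have hw_meas : AEMeasurable w := hw_int.aestronglyMeasurable.aemeasurable
  have hW := weightMeasure_toSet_ne_top hw_int
  rw [ENNReal.coe_toNNReal hK_top]
  have hnorm : eLpNorm f 2 (weightMeasure w) ^ 2 = ∫⁻ x, ‖f x‖ₑ ^ 2 ∂weightMeasure w := by
    have := eLpNorm_nnreal_pow_eq_lintegral (f := f) (μ := weightMeasure w) (p := 2) two_ne_zero
    simpa using this
  have hfI : ∀ I : DyadicInterval, ∫⁻ x in I.toSet, ‖f x‖ₑ ∂weightMeasure w ≠ ∞ := fun I => by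
    have : IsFiniteMeasure ((weightMeasure w).restrict I.toSet) :=
      isFiniteMeasure_restrict.2 (hW I)
    exact ((hf.restrict I.toSet).integrable one_le_two).2.ne
  rw [hnorm, ENNReal.tsum_eq_iSup_sum]
  refine iSup_le fun F => ?_
  refine le_trans (Finset.sum_le_sum fun I _ => ?_)
    ((ha.isCarleson_weightMeasure hφ_mono hφ_ge hw hw_meas).weighted_embedding hW
      hf.1.aemeasurable F)
  calc _ ≤ ((weightMeasure w I.toSet / volume I.toSet) ^ 2 *
        ENNReal.ofReal (((∫⁻ x in I.toSet, ‖f x‖ₑ ∂weightMeasure w)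
          / weightMeasure w I.toSet).toReal ^ 2))
            / bumpFunctional φ (normalizedDistribution w I)
            * ENNReal.ofReal (a I) * volume I.toSet := by
        gcongr
        exact ofReal_sq_dyadicAverage_le hw hw_meas (hW I) (hfI I)
    _ = _ := by
        simp only [div_eq_mul_inv]
        ring
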